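/- A unary exclusive nondeterministic finite automaton (XNFA) $M=\langle Q,\{a\},\delta,q_0,F\rangle$ has a finite state set $Q$, a single initial state $q_0$, accepting states $F\subseteq Q$ and a transition function $\delta:Q\times\{a\}\to 2^Q$. A path for $a^z$ is a state sequence $q_0=r_0,r_1,\dots,r_z$ with $r_{i+1}\in\delta(r_i,a)$; it is accepting if $r_z\in F$. The word $a^z$ belongs to $L(M)$ if and only if it has exactly one accepting path. A unary XNFA is in Chrobak normal form if its states are $q_0,\dots,q_m$ ($m\ge 0$), called the tail, together with $k\ge 0$ disjoint cycles $C_i=\{p_{i,0},\dots,p_{i,d_i-1}\}$ with $d_i\ge 1$ ($1\le i\le k$), its initial state is $q_0$, and its transitions are $\delta(q_i,a)=\{q_{i+1}\}$ for $i<m$, $\delta(q_m,a)=\{p_{1,0},\dots,p_{k,0}\}$ and $\delta(p_{i,h},a)=\{p_{i,(h+1)\bmod d_i}\}$. Let $F(n)=\max\{\mathrm{lcm}(c_1,\dots,c_l)\mid l\ge 1,\ c_i\ge 1,\ c_1+\cdots+c_l=n\}$ be Landau's function. DFAs are complete (their transition function is total). Theorem. There is a constant $C\in\mathbb N$ such that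 $$\ln\bigl(Cn^3+F(n)\bigr)=\Theta\bigl(\sqrt{n\ln n}\bigr)\qquad(n\to\infty),$$ that is, $Cn^3+F(n)\in e^{\Theta(\sqrt{n\ln n})}$, and such that for every $n\ge 1$ and every unary $n$-state XNFA $M$, $Cn^3+F(n)$ states are sufficient for a DFA to accept $L(M)$. More precisely, for every such $M$ there is a unary XNFA $M'$ in Chrobak normal form (with tail $q_0,\dots,q_m$ and cycles of lengths $d_1,\dots,d_k$ as above) with $L(M')=L(M)$, with at most $Cn^3$ states and with $d_1+\cdots+d_k\le Cn$, such that the following DFA $M''$ satisfies $L(M'')=L(M)$. Let $\ell=\mathrm{lcm}(d_1,\dots,d_k)$ ($\ell=1$ if $k=0$). The states of $M''$ are the tail $q_0,\dots,q_m$, with $q_0$ initial, followed by one cycle $p_0,\dots,p_{\ell-1}$; its transitions are $q_i\mapsto q_{i+1}$ for $i<m$, $q_m\mapsto p_0$ and $p_t\mapsto p_{(t+1)\bmod \ell}$; a tail state is accepting if and only if it is accepting in $M'$; and $p_t$ is accepting if and only if there is exactly one accepting cycle state $p_{i,h}$ of $M'$ with $t=h+x\,d_i$ for some integer $x\ge 0$.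 The tail of $M''$ has at most $Cn^3$ states, $\ell\le F(n)$, and $M''$ has at most $Cn^3+F(n)$ states. -/

import Mathlib

/-- An exclusive nondeterministic finite automaton: a nondeterministic automaton with one initial
state, used with the acceptance mode `XNFA.accepts` below. -/
structure XNFA (α σ : Type*) where
  step : σ → α → Set σ
  start : σ
  accept : Set σ

namespace XNFA

/-- The state sequence `p 0, …, p |w|` is a (complete) path for `w`. -/
def IsPath {α σ : Type*} (M : XNFA α σ) (w : List α) (p : Fin (w.length + 1) → σ) : Prop :=
  p 0 = M.start ∧ ∀ i : Fin w.length, p i.succ ∈ M.step (p i.castSucc) (w.get i)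

/-- A path for `w` that ends in an accepting state. -/
def IsAcceptingPath {α σ : Type*} (M : XNFA α σ) (w : List α) (p : Fin (w.length + 1) → σ) :
    Prop :=
  M.IsPath w p ∧ p (Fin.last w.length) ∈ M.accept

/-- The words with exactly one accepting path. -/
def accepts {α σ : Type*} (M : XNFA α σ) : Language α :=
  {w | ∃! p : Fin (w.length + 1) → σ, M.IsAcceptingPath w p}

end XNFA

/-- The data of a unary automaton in Chrobak normal form: a tail `q_0, …, q_m`, then
`k` disjoint cycles of lengths `len i ≥ 1`, and an arbitrary set of accepting states. -/
structure Chrobak where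
  m : ℕ
  k : ℕ
  len : Fin k → ℕ
  len_pos : ∀ i, 1 ≤ len i
  /-- The accepting states on the tail. -/
  tailAccept : Set (Fin (m + 1))
  /-- The accepting states on the cycles. -/
  cycleAccept : Set (Σ i : Fin k, Fin (len i))

namespace Chrobak

/-- The states: `Sum.inl i` is the tail state `q_i`, and `Sum.inr ⟨i, h⟩` is the state `p_{i,h}`
of the `i`-th cycle. -/
abbrev State (N : Chrobak) : Type :=
  Fin (N.m + 1) ⊕ (Σ i : Fin N.k, Fin (N.len i))

/-- `q_i ↦ {q_{i+1}}` for `i < m`, `q_m ↦ {p_{1,0}, …, p_{k,0}}`, and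
`p_{i,h} ↦ {p_{i,(h+1) mod len i}}`. -/
def step (N : Chrobak) : N.State → Set N.State
  | Sum.inl i =>
      if h : i.val < N.m then {Sum.inl ⟨i.val + 1, Nat.succ_lt_succ h⟩}
      else Set.range fun c : Fin N.k => Sum.inr ⟨c, ⟨0, N.len_pos c⟩⟩
  | Sum.inr s =>
      {Sum.inr ⟨s.1, ⟨(s.2.val + 1) % N.len s.1, Nat.mod_lt _ (N.len_pos s.1)⟩⟩}

/-- The unary XNFA in Chrobak normal form. -/
def toXNFA (N : Chrobak) : XNFA Unit N.State where
  step q _ := N.step q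
  start := Sum.inl 0
  accept := Sum.inl '' N.tailAccept ∪ Sum.inr '' N.cycleAccept

/-- The least common multiple of the cycle lengths (`1` if there is no cycle). -/
def period (N : Chrobak) : ℕ := Finset.univ.lcm N.len

theorem period_pos (N : Chrobak) : 0 < N.period := by
  refine Nat.pos_of_ne_zero fun h => ?_
  obtain ⟨i, -, hi⟩ := Finset.lcm_eq_zero_iff.mp h
  have := N.len_pos i
  omega

/-- States of the determinization: the same tail, and one cycle of length `N.period`. -/
abbrev DState (N : Chrobak) : Type := Fin (N.m + 1) ⊕ Fin N.period

/-- The deterministic automaton that follows the tail `q_0, …, q_m` and then the cycle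
`p_0, …, p_{ℓ-1}`, `ℓ = N.period`. The tail keeps its accepting states. The state `p_t` is
accepting exactly when there is exactly one accepting state `p_{i,h}` on the cycles of `N` with
`t = h + x * len i` for some `x ≥ 0`. -/
def toDFA (N : Chrobak) : DFA Unit N.DState where
  step q _ :=
    match q with
    | Sum.inl i =>
        if h : i.val < N.m then Sum.inl ⟨i.val + 1, Nat.succ_lt_succ h⟩
        else Sum.inr ⟨0, N.period_pos⟩
    | Sum.inr t => Sum.inr ⟨(t.val + 1) % N.period, Nat.mod_lt _ N.period_pos⟩
  start := Sum.inl 0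
  accept := Sum.inl '' N.tailAccept ∪ Sum.inr '' {t : Fin N.period |
    ∃! s : (Σ i : Fin N.k, Fin (N.len i)),
      s ∈ N.cycleAccept ∧ ∃ x : ℕ, t.val = s.2.val + x * N.len s.1}

end Chrobak

/-- Landau's function: the maximum of `lcm (c_1, …, c_l)` over all ways to write
`n = c_1 + ⋯ + c_l` with positive integers `c_i`. -/
def landau (n : ℕ) : ℕ := Finset.univ.sup fun p : n.Partition => p.parts.lcm

/-!
The language of a unary automaton `M` with `n` states is `{z | f z = 1}`, where `f z`
(`acceptCount`) is the number of walks of length `z` from the initial state to accepting states,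
a sum of entries of the `z`-th power of the adjacency matrix. The point is to write, for large `z`,
the condition `f z = 1` as "exactly one of a few periodic conditions holds", with periods of sum at
most `2 * n`; these conditions are the cycles of the normal form (`exists_chrobak`).

Let `T` represent the strongly connected components that contain a cycle, and let `d u`
(`cycLen`) be the length of a shortest cycle through `u ∈ T`. As such a cycle stays in the
component of `u`, the `d u` have sum at most `n`. Call `u` active at `z` if, modulo `d u`, there is
an accepting walk of length `z` through `u` (`Through`). Every long accepting walk makes some `u`
active. Conversely, if `u` is active at `z` and `z` is large, then there is an accepting walk of
length exactly `z` that stays in the component of `u` apart from short parts at both ends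
(`Through.exists_mid`). Hence no active `u` means `f z = 0`, and two active ones give `f z ≥ 2`.

There remains the case of a single active `u`. If its component has a state with two successors in
the component, then closed walks can be composed in two orders and `f z ≥ 2` for all
large `z` at which `u` is active (`Branching.two_le_acceptCount`). Otherwise the component is
a simple cycle, and lengthening or
shortening the stay in it by multiples of `d u` shows that `f z ≥ 2` depends on `z` modulo `d u`
only (`acceptCount_le_of_not_branching`). So two cycles of length `d u` are enough for each `u`: one
accepts if `u` is active, and the other one if `f ≥ 2` throughout the residue class
(`CycleAccepts`, `acceptCount_eq_one_iff`). All bounds on "large" are `O(n ^ 3)`.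

Since the distinct representatives have cycle lengths of sum at most `n`, the period is at most
`landau n` (`lcm_le_landau`). The logarithm of `landau n` is of order `√(n log n)`: parts
up to `√(n log n)` contribute a divisor of `lcm (1, …, ⌈√(n log n)⌉)`, and there are few larger
parts; for the lower bound, take the primes up to `√(n log n) / 2` as the parts. Both bounds rest on
Chebyshev's estimates.
-/

/-! ### The growth of Landau's function -/

/-- The missing part of the sum is filled up with parts equal to `1`. -/
theorem lcm_le_landau {ι : Type*} (s : Finset ι) (d : ι → ℕ) (hd : ∀ i ∈ s, d i ≠ 0) {n : ℕ}
    (h : ∑ i ∈ s, d i ≤ n) : s.lcm d ≤ landau n := by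
  let p : n.Partition :=
    { parts := s.val.map d + Multiset.replicate (n - ∑ i ∈ s, d i) 1
      parts_pos := by
        intro i hi
        rcases Multiset.mem_add.mp hi with hi | hi
        · obtain ⟨j, hj, rfl⟩ := Multiset.mem_map.mp hi
          exact Nat.pos_of_ne_zero (hd j hj)
        · rw [Multiset.eq_of_mem_replicate hi]
          exact one_pos
      parts_sum := by
        rw [Multiset.sum_add, Multiset.sum_replicate, smul_eq_mul, mul_one]
        exact Nat.add_sub_cancel' h }
  have hdvd : s.lcm d ∣ p.parts.lcm := Finset.lcm_dvd fun i hi =>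
    Multiset.dvd_lcm (Multiset.mem_add.mpr (Or.inl (Multiset.mem_map_of_mem d hi)))
  have hpos : p.parts.lcm ≠ 0 := by
    rw [Multiset.lcm_ne_zero_iff]
    exact fun h0 => (p.parts_pos h0).ne rfl
  exact (Nat.le_of_dvd (Nat.pos_of_ne_zero hpos) hdvd).trans
    (Finset.le_sup (f := fun p : n.Partition => p.parts.lcm) (Finset.mem_univ p))

theorem one_le_landau (n : ℕ) : 1 ≤ landau n := by
  simpa using lcm_le_landau (∅ : Finset ℕ) id (n := n) (by simp) (by simp)

/-- Parts at most `T` contribute a divisor of `lcm (1, …, T)`, and there are at most `n / T`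
larger parts, each of which is at most `n`. -/
theorem landau_le_lcmUpto_mul_pow {n : ℕ} (hn : 1 ≤ n) {T : ℕ} (hT : 0 < T) :
    landau n ≤ Nat.lcmUpto T * n ^ (n / T) := by
  refine Finset.sup_le fun p _ => ?_
  set large := p.parts.filter (T < ·) with hlarge
  have hdvd : p.parts.lcm ∣ Nat.lcmUpto T * large.prod := by
    refine Multiset.lcm_dvd.mpr fun c hc => ?_
    by_cases hcT : T < c
    · exact (Multiset.dvd_prod (Multiset.mem_filter.mpr ⟨hc, hcT⟩)).mul_left _
    · refine Dvd.dvd.mul_right ?_ _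
      exact Finset.dvd_lcm (f := id) (Finset.mem_Icc.mpr ⟨p.parts_pos hc, not_lt.mp hcT⟩)
  have hprod : large.prod ≤ n ^ large.card :=
    Multiset.prod_le_pow_card _ _ fun c hc =>
      p.le_of_mem_parts (Multiset.mem_filter.mp hc).1
  have hcard : large.card ≤ n / T := by
    rw [Nat.le_div_iff_mul_le hT]
    have h1 : large.card • T ≤ large.sum :=
      Multiset.card_nsmul_le_sum fun c hc => (Multiset.mem_filter.mp hc).2.le
    have h2 : large.sum ≤ p.parts.sum := by
      rw [← Multiset.sum_filter_add_sum_filter_not (s := p.parts) (T < ·)]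
      exact Nat.le_add_right _ _
    rw [p.parts_sum] at h2
    exact h1.trans h2
  have hlpos : 0 < large.prod :=
    Multiset.prod_pos fun c hc => p.parts_pos (Multiset.mem_filter.mp hc).1
  exact (Nat.le_of_dvd (Nat.mul_pos (Nat.lcmUpto_pos T) hlpos) hdvd).trans
    (Nat.mul_le_mul_left _ (hprod.trans (Nat.pow_le_pow_right hn hcard)))

theorem tendsto_sqrt_mul_log_atTop :
    Filter.Tendsto (fun n : ℕ => √((n : ℝ) * Real.log n)) Filter.atTop Filter.atTop :=
  Real.tendsto_sqrt_atTop.comp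
    ((Filter.tendsto_id.atTop_mul_atTop₀ Real.tendsto_log_atTop).comp tendsto_natCast_atTop_atTop)

theorem log_landau_le {n : ℕ} (hn : 1 ≤ n) (hs : 1 ≤ √((n : ℝ) * Real.log n)) :
    Real.log (landau n) ≤ 13 * √((n : ℝ) * Real.log n) := by
  set s := √((n : ℝ) * Real.log n) with hsdef
  have hn' : (1 : ℝ) ≤ n := by exact_mod_cast hn
  have hlog : 0 ≤ Real.log n := Real.log_nonneg hn'
  have hss : s * s = n * Real.log n := Real.mul_self_sqrt (by positivity)
  have hT : 0 < ⌈s⌉₊ := Nat.ceil_pos.mpr (by linarith)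
  have hsT : s ≤ ⌈s⌉₊ := Nat.le_ceil s
  have hTs : (⌈s⌉₊ : ℝ) ≤ 2 * s := by
    have := Nat.ceil_lt_add_one (a := s) (by linarith)
    linarith
  have hle : (landau n : ℝ) ≤ (Nat.lcmUpto ⌈s⌉₊ : ℝ) * (n : ℝ) ^ (n / ⌈s⌉₊) := by
    exact_mod_cast landau_le_lcmUpto_mul_pow hn hT
  have hU : (Nat.lcmUpto ⌈s⌉₊ : ℝ) ≠ 0 := by
    exact_mod_cast Nat.lcmUpto_ne_zero _
  have h1 := Real.log_le_log (by exact_mod_cast one_le_landau n) hle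
  rw [Real.log_mul hU (by positivity), Real.log_pow, ← Chebyshev.psi_eq_log_lcmUpto] at h1
  have h2 : Chebyshev.psi (⌈s⌉₊ : ℝ) ≤ 6 * (2 * s) := by
    have := Chebyshev.psi_le_const_mul_self (x := (⌈s⌉₊ : ℝ)) (by positivity)
    have hl4 : Real.log 4 ≤ 2 := by
      rw [show (4 : ℝ) = 2 * 2 by norm_num, Real.log_mul (by norm_num) (by norm_num)]
      linarith [Real.log_two_lt_d9]
    nlinarith
  have h3 : ((n / ⌈s⌉₊ : ℕ) : ℝ) * Real.log n ≤ s := by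
    have h4 : ((n / ⌈s⌉₊ : ℕ) : ℝ) ≤ n / s :=
      Nat.cast_div_le.trans (div_le_div_of_nonneg_left (by positivity) (by linarith) hsT)
    calc ((n / ⌈s⌉₊ : ℕ) : ℝ) * Real.log n ≤ n / s * Real.log n :=
          mul_le_mul_of_nonneg_right h4 hlog
      _ = s := by
          rw [div_mul_eq_mul_div, ← hss]
          field_simp
  linarith

theorem eventually_div_four_le_theta :
    ∀ᶠ x : ℝ in Filter.atTop, x / 4 ≤ Chebyshev.theta x := by
  obtain ⟨C, hC⟩ := Chebyshev.psi_sub_theta_le_mul_sqrt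
  have h1 : ∀ᶠ x : ℝ in Filter.atTop, |Real.log (x + 2)| ≤ 1 / 16 * |x + 2| :=
    ((Real.isLittleO_log_id_atTop.comp_tendsto
      (Filter.tendsto_atTop_add_const_right _ (2 : ℝ) Filter.tendsto_id)).def (by norm_num))
  have h2 : ∀ᶠ x : ℝ in Filter.atTop, 16 * |C| ≤ √x :=
    Real.tendsto_sqrt_atTop.eventually_ge_atTop _
  filter_upwards [h1, h2, Filter.eventually_ge_atTop 100] with x h1 h2 hx
  have h3 := hC x
  have h4 := Chebyshev.psi_ge' (x := x) (by linarith)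
  have h5 : Real.log (x + 2) ≤ 1 / 16 * (x + 2) := by
    rw [abs_of_pos (show (0 : ℝ) < x + 2 by linarith)] at h1
    exact (le_abs_self _).trans h1
  have h6 : C * √x ≤ x / 16 := by
    have : √x * √x = x := Real.mul_self_sqrt (by linarith)
    nlinarith [le_abs_self C, Real.sqrt_nonneg x]
  nlinarith [Real.log_two_gt_d9]

/-- The primes up to `√(n log n) / 2` have sum at most `n`, so their product, whose logarithm
Chebyshev's estimate bounds from below, is at most `landau n`. -/
theorem eventually_le_log_landau :
    ∀ᶠ n : ℕ in Filter.atTop, √((n : ℝ) * Real.log n) / 8 ≤ Real.log (landau n) := by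
  have hlim : Filter.Tendsto (fun n : ℕ => √((n : ℝ) * Real.log n) / 2)
      Filter.atTop Filter.atTop := tendsto_sqrt_mul_log_atTop.atTop_div_const (by norm_num)
  have hpi := hlim.eventually (Chebyshev.eventually_primeCounting_le (ε := 1 / 2) (by norm_num))
  have htheta := hlim.eventually eventually_div_four_le_theta
  have hlog : ∀ᶠ n : ℕ in Filter.atTop, 4 ≤ Real.log (n : ℝ) :=
    (Real.tendsto_log_atTop.comp tendsto_natCast_atTop_atTop).eventually_ge_atTop 4
  filter_upwards [hpi, htheta, hlog, Filter.eventually_ge_atTop 1,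
    hlim.eventually_ge_atTop 1] with n hpi htheta hlog hn hx1
  set x := √((n : ℝ) * Real.log n) / 2 with hx
  have hn' : (1 : ℝ) ≤ n := by exact_mod_cast hn
  have hxx : x * x = n * Real.log n / 4 := by
    have : √((n : ℝ) * Real.log n) * √((n : ℝ) * Real.log n) = n * Real.log n :=
      Real.mul_self_sqrt (by positivity)
    rw [hx]
    linarith
  have hlogx : Real.log n / 2 ≤ Real.log x := by
    have h1 : Real.log n ≤ Real.log (x * x) :=
      Real.log_le_log (by positivity) (by rw [hxx]; nlinarith)
    rw [Real.log_mul (by positivity) (by positivity)] at h1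
    linarith
  have hsum : ∑ p ∈ Nat.primesLE ⌊x⌋₊, p ≤ n := by
    have h1 : ((∑ p ∈ Nat.primesLE ⌊x⌋₊, p : ℕ) : ℝ) ≤ Nat.primeCounting ⌊x⌋₊ * x := by
      rw [← Nat.primesLE_card_eq_primeCounting, ← nsmul_eq_mul, Nat.cast_sum]
      refine Finset.sum_le_card_nsmul _ _ _ fun p hp => ?_
      have : p ≤ ⌊x⌋₊ := Nat.le_of_mem_primesLE hp
      exact (Nat.cast_le.mpr this).trans (Nat.floor_le (by linarith))
    have hl4 : Real.log 4 + 1 / 2 ≤ 2 := by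
      rw [show (4 : ℝ) = 2 * 2 by norm_num, Real.log_mul (by norm_num) (by norm_num)]
      linarith [Real.log_two_lt_d9]
    have h2 : (Nat.primeCounting ⌊x⌋₊ : ℝ) * x ≤ n := by
      calc (Nat.primeCounting ⌊x⌋₊ : ℝ) * x
          ≤ ((Real.log 4 + 1 / 2) * x / Real.log x) * x := by gcongr
        _ ≤ (2 * x / (Real.log n / 2)) * x := by gcongr
        _ = n := by
          rw [div_mul_eq_mul_div, mul_assoc, hxx]
          field_simp
          norm_num
    exact_mod_cast h1.trans h2
  have hprim : ∏ p ∈ Nat.primesLE ⌊x⌋₊, p ≤ landau n := by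
    refine le_trans (le_of_eq ?_) (lcm_le_landau (Nat.primesLE ⌊x⌋₊) id
      (fun p hp => (Nat.prime_of_mem_primesLE hp).ne_zero) hsum)
    exact (Finset.lcm_eq_prod fun p hp q hq hpq =>
      (Nat.coprime_primes (Nat.prime_of_mem_primesLE hp) (Nat.prime_of_mem_primesLE hq)).mpr
        hpq).symm
  have : Chebyshev.theta x ≤ Real.log (landau n) := by
    rw [Chebyshev.theta_eq_theta_coe_floor, Chebyshev.theta_eq_sum_primesLE_log,
      ← Real.log_prod (fun p hp => by
        exact_mod_cast (Nat.prime_of_mem_primesLE hp).ne_zero), ← Nat.cast_prod]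
    refine Real.log_le_log ?_ (by exact_mod_cast hprim)
    exact_mod_cast Finset.prod_pos fun p hp => (Nat.prime_of_mem_primesLE hp).pos
  linarith

open Asymptotics in
theorem log_cube_add_landau_isTheta (C : ℕ) :
    (fun n : ℕ => Real.log ((C * n ^ 3 + landau n : ℕ) : ℝ)) =Θ[Filter.atTop]
      (fun n : ℕ => √((n : ℝ) * Real.log (n : ℝ))) := by
  constructor
  · have hlog : ∀ᶠ n : ℕ in Filter.atTop, Real.log (C + 1) + 1 ≤ Real.log (n : ℝ) :=
      (Real.tendsto_log_atTop.comp tendsto_natCast_atTop_atTop).eventually_ge_atTop _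
    refine IsBigO.of_bound 17 ?_
    filter_upwards [hlog, Filter.eventually_ge_atTop 1,
      tendsto_sqrt_mul_log_atTop.eventually_ge_atTop 1] with n hlog hn hs
    have hn' : (1 : ℝ) ≤ n := by exact_mod_cast hn
    have hl : (1 : ℝ) ≤ landau n := by exact_mod_cast one_le_landau n
    have hC0 : 0 ≤ Real.log ((C : ℝ) + 1) := Real.log_nonneg (by simp)
    rw [Real.norm_of_nonneg (Real.log_natCast_nonneg _), Real.norm_of_nonneg (Real.sqrt_nonneg _)]
    have hle : ((C * n ^ 3 + landau n : ℕ) : ℝ) ≤ (C + 1) * n ^ 3 * landau n := by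
      push_cast
      have h3 : (1 : ℝ) ≤ (n : ℝ) ^ 3 := one_le_pow₀ hn'
      have hC : (0 : ℝ) ≤ C := Nat.cast_nonneg C
      have h4 : (C : ℝ) * n ^ 3 * 1 ≤ C * n ^ 3 * landau n := by gcongr
      have h5 : 1 * (landau n : ℝ) ≤ n ^ 3 * landau n := by gcongr
      linarith
    have hpos : (0 : ℝ) < ((C * n ^ 3 + landau n : ℕ) : ℝ) := by
      exact_mod_cast Nat.add_pos_right _ (one_le_landau n)
    have h1 := Real.log_le_log hpos hle
    rw [Real.log_mul (by positivity) (by positivity), Real.log_mul (by positivity) (by positivity),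
      Real.log_pow] at h1
    have h2 : Real.log n ≤ √((n : ℝ) * Real.log n) := by
      refine Real.le_sqrt_of_sq_le ?_
      rw [sq]
      have := Real.log_le_self (x := (n : ℝ)) (by linarith)
      gcongr
    have h3 := log_landau_le hn hs
    push_cast at h1 ⊢
    linarith
  · refine IsBigO.of_bound 8 ?_
    filter_upwards [eventually_le_log_landau] with n hn
    rw [Real.norm_of_nonneg (Real.log_natCast_nonneg _), Real.norm_of_nonneg (Real.sqrt_nonneg _)]
    have : Real.log (landau n) ≤ Real.log ((C * n ^ 3 + landau n : ℕ) : ℝ) :=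
      Real.log_le_log (by exact_mod_cast one_le_landau n) (by exact_mod_cast Nat.le_add_left _ _)
    linarith

/-! ### Automata in Chrobak normal form and their determinization -/

namespace Chrobak

/-- The state reached after `t` steps by the run that enters the `c`-th cycle. -/
def run (N : Chrobak) (c : Fin N.k) (t : ℕ) : N.State :=
  if h : t < N.m + 1 then Sum.inl ⟨t, h⟩
  else Sum.inr ⟨c, ⟨(t - (N.m + 1)) % N.len c, Nat.mod_lt _ (N.len_pos c)⟩⟩

theorem eq_inl_of_isPath (N : Chrobak) {w : List Unit} {p : Fin (w.length + 1) → N.State}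
    (hp : N.toXNFA.IsPath w p) (i : Fin (w.length + 1)) (h : i.val < N.m + 1) :
    p i = Sum.inl ⟨i.val, h⟩ := by
  induction i using Fin.induction with
  | zero => exact hp.1
  | succ i ih =>
    have hi : i.val < N.m := by simpa using h
    have hs := hp.2 i
    rw [ih (by simpa using hi.trans (Nat.lt_succ_self _))] at hs
    simpa [toXNFA, step, hi] using hs

theorem isPath_run (N : Chrobak) (w : List Unit) (c : Fin N.k) :
    N.toXNFA.IsPath w fun i => N.run c i.val := by
  refine ⟨by simp [run, toXNFA], fun i => ?_⟩
  simp only [toXNFA, run, Fin.val_succ, Fin.val_castSucc]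
  rcases lt_trichotomy i.val N.m with h | h | h
  · have h1 : i.val < N.m + 1 := by omega
    simp [step, h, h1]
  · simp [step, h]
  · have h1 : ¬ i.val < N.m + 1 := by omega
    have h2 : ¬ i.val + 1 < N.m + 1 := by omega
    have h3 : i.val + 1 - (N.m + 1) = i.val - (N.m + 1) + 1 := by omega
    simp [step, h1, h2, h3]

/-- Past the tail, the only choice on a path is the cycle entered from `q_m`. -/
theorem exists_eq_run (N : Chrobak) {w : List Unit} (hw : N.m < w.length)
    {p : Fin (w.length + 1) → N.State} (hp : N.toXNFA.IsPath w p) :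
    ∃ c, p = fun i => N.run c i.val := by
  obtain ⟨c, hc⟩ : ∃ c : Fin N.k, Sum.inr ⟨c, ⟨0, N.len_pos c⟩⟩ = p (Fin.succ ⟨N.m, hw⟩) := by
    have hs := hp.2 ⟨N.m, hw⟩
    rw [N.eq_inl_of_isPath hp (Fin.castSucc ⟨N.m, hw⟩) (by simp)] at hs
    simpa [toXNFA, step] using hs
  refine ⟨c, funext fun i => ?_⟩
  induction i using Fin.induction with
  | zero => rw [N.eq_inl_of_isPath hp 0 (by simp)]; simp [run]
  | succ i ih =>
    rcases lt_trichotomy i.val N.m with h | h | h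
    · rw [N.eq_inl_of_isPath hp i.succ (by simpa using h)]
      simp [run, h]
    · have : i = ⟨N.m, hw⟩ := Fin.ext h
      rw [this, ← hc]
      simp [run]
    · have hs := hp.2 i
      have h1 : ¬ i.val < N.m + 1 := by omega
      have h2 : i.val + 1 - (N.m + 1) = i.val - (N.m + 1) + 1 := by omega
      rw [ih] at hs
      simpa [toXNFA, run, step, h1, h.not_gt, h2] using hs

theorem mem_accepts_of_le (N : Chrobak) {w : List Unit} (hw : w.length < N.m + 1) :
    w ∈ N.toXNFA.accepts ↔ ⟨w.length, hw⟩ ∈ N.tailAccept := by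
  have hpath : N.toXNFA.IsPath w fun i => Sum.inl ⟨i.val, i.isLt.trans_le hw⟩ := by
    refine ⟨rfl, fun i => ?_⟩
    have hi : i.val < N.m := by omega
    simp [toXNFA, step, hi]
  have huniq : ∀ p, N.toXNFA.IsPath w p → p = fun i => Sum.inl ⟨i.val, i.isLt.trans_le hw⟩ :=
    fun p hp => funext fun i => N.eq_inl_of_isPath hp i _
  constructor
  · rintro ⟨p, ⟨hp, ha⟩, -⟩
    rw [huniq p hp] at ha
    simpa [toXNFA] using ha
  · intro h
    exact ⟨_, ⟨hpath, by simpa [toXNFA] using h⟩, fun p hp => huniq p hp.1⟩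

theorem mem_accepts_of_lt (N : Chrobak) {w : List Unit} (hw : N.m < w.length) :
    w ∈ N.toXNFA.accepts ↔ ∃! c : Fin N.k,
      (⟨c, ⟨(w.length - (N.m + 1)) % N.len c, Nat.mod_lt _ (N.len_pos c)⟩⟩ :
        Σ i : Fin N.k, Fin (N.len i)) ∈ N.cycleAccept := by
  have hrun : ∀ c : Fin N.k, N.run c w.length =
      Sum.inr ⟨c, ⟨(w.length - (N.m + 1)) % N.len c, Nat.mod_lt _ (N.len_pos c)⟩⟩ := fun c => by
    simp [run, hw]
  have hacc : ∀ c : Fin N.k, N.toXNFA.IsAcceptingPath w (fun i => N.run c i.val) ↔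
      (⟨c, ⟨(w.length - (N.m + 1)) % N.len c, Nat.mod_lt _ (N.len_pos c)⟩⟩ :
        Σ i : Fin N.k, Fin (N.len i)) ∈ N.cycleAccept := fun c => by
    rw [XNFA.IsAcceptingPath, and_iff_right (N.isPath_run w c), Fin.val_last, hrun]
    simp [toXNFA]
  constructor
  · rintro ⟨p, hp, huniq⟩
    obtain ⟨c, rfl⟩ := N.exists_eq_run hw hp.1
    refine ⟨c, (hacc c).mp hp, fun c' hc' => ?_⟩
    have := congrFun (huniq _ ((hacc c').mpr hc')) (Fin.last _)
    simp only [Fin.val_last, hrun] at this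
    exact congrArg Sigma.fst (Sum.inr_injective this)
  · rintro ⟨c, hc, huniq⟩
    refine ⟨_, (hacc c).mpr hc, fun p hp => ?_⟩
    obtain ⟨c', rfl⟩ := N.exists_eq_run hw hp.1
    rw [huniq c' ((hacc c').mp hp)]

theorem toDFA_eval (N : Chrobak) (w : List Unit) :
    N.toDFA.eval w = if h : w.length < N.m + 1 then Sum.inl ⟨w.length, h⟩
      else Sum.inr ⟨(w.length - (N.m + 1)) % N.period, Nat.mod_lt _ N.period_pos⟩ := by
  induction w using List.reverseRecOn with
  | nil => simp [toDFA]
  | append_singleton w a ih =>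
    rw [DFA.eval_append_singleton, ih]
    simp only [List.length_append, List.length_singleton]
    rcases lt_trichotomy w.length N.m with h | h | h
    · simp [toDFA, h, h.trans (Nat.lt_succ_self _)]
    · simp [toDFA, h]
    · have h1 : ¬ w.length < N.m + 1 := by omega
      have h2 : w.length + 1 - (N.m + 1) = w.length - (N.m + 1) + 1 := by omega
      simp [toDFA, h1, h.not_gt, h2]

theorem toDFA_accepts (N : Chrobak) : N.toDFA.accepts = N.toXNFA.accepts := by
  ext w
  rw [DFA.mem_accepts, toDFA_eval]
  by_cases hw : w.length < N.m + 1
  · rw [N.mem_accepts_of_le hw]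
    simp [hw, toDFA]
  · rw [N.mem_accepts_of_lt (by omega)]
    have hmod : ∀ c, (w.length - (N.m + 1)) % N.len c =
        (w.length - (N.m + 1)) % N.period % N.len c := fun c =>
      (Nat.mod_mod_of_dvd _ (Finset.dvd_lcm (Finset.mem_univ c))).symm
    -- A state `p_{i,h}` of the `i`-th cycle satisfies `t = h + x * len i` iff
    -- `h = t % len i`, and `len i` divides the period.
    have hs : ∀ s : (Σ i : Fin N.k, Fin (N.len i)), 
        (∃ x : ℕ, (w.length - (N.m + 1)) % N.period = s.2.val + x * N.len s.1) ↔
        s = ⟨s.1, ⟨(w.length - (N.m + 1)) % N.len s.1, Nat.mod_lt _ (N.len_pos s.1)⟩⟩ := by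
      rintro ⟨c, h⟩
      simp only [Sigma.mk.injEq, heq_eq_eq, true_and, Fin.ext_iff, hmod]
      constructor
      · rintro ⟨x, hx⟩
        rw [hx, Nat.add_mul_mod_self_right, Nat.mod_eq_of_lt h.isLt]
      · intro hx
        exact ⟨(w.length - (N.m + 1)) % N.period / N.len c, by rw [hx, mul_comm, Nat.mod_add_div]⟩
    simp only [hw, toDFA, dite_false, Set.mem_union, Set.mem_image, reduceCtorEq, and_false,
      exists_false, false_or, Sum.inr.injEq, exists_eq_right, Set.mem_ofPred_eq, hs]
    constructor
    · rintro ⟨s, ⟨hs1, hs2⟩, huniq⟩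
      refine ⟨s.1, hs2 ▸ hs1, fun c hc => ?_⟩
      exact congrArg Sigma.fst (huniq ⟨c, _⟩ ⟨hc, rfl⟩)
    · rintro ⟨c, hc, huniq⟩
      refine ⟨⟨c, _⟩, ⟨hc, rfl⟩, ?_⟩
      rintro ⟨c', h'⟩ ⟨h1, h2⟩
      have : c' = c := huniq c' (by rwa [h2] at h1)
      subst this
      exact h2

end Chrobak

/-! ### Walks and components of finite graphs -/

/-- `HasWalk A t p q`: the graph with edge multiplicities `A` has a walk of length `t` from `p`
to `q`. -/
def HasWalk {σ : Type*} [Fintype σ] [DecidableEq σ] (A : Matrix σ σ ℕ) (t : ℕ) (p q : σ) : Prop :=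
  0 < (A ^ t) p q

section Walks

variable {σ : Type*} [Fintype σ] [DecidableEq σ] {A : Matrix σ σ ℕ}

theorem pow_add_apply (s t : ℕ) (p q : σ) :
    (A ^ (s + t)) p q = ∑ r, (A ^ s) p r * (A ^ t) r q := by
  rw [pow_add, Matrix.mul_apply]

theorem mul_le_pow_add_apply (s t : ℕ) (p q r : σ) :
    (A ^ s) p r * (A ^ t) r q ≤ (A ^ (s + t)) p q := by
  rw [pow_add_apply]
  exact Finset.single_le_sum (f := fun r => (A ^ s) p r * (A ^ t) r q) (fun _ _ => Nat.zero_le _)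
    (Finset.mem_univ r)

theorem hasWalk_zero (p : σ) : HasWalk A 0 p p := by simp [HasWalk]

theorem HasWalk.trans {s t : ℕ} {p q r : σ} (h₁ : HasWalk A s p q) (h₂ : HasWalk A t q r) :
    HasWalk A (s + t) p r :=
  (Nat.mul_pos h₁ h₂).trans_le (mul_le_pow_add_apply s t p r q)

theorem HasWalk.exists_mid {s t : ℕ} {p r : σ} (h : HasWalk A (s + t) p r) :
    ∃ q, HasWalk A s p q ∧ HasWalk A t q r := by
  rw [HasWalk, pow_add_apply, Finset.sum_pos_iff] at h
  obtain ⟨q, -, hq⟩ := h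
  exact ⟨q, Nat.pos_of_mul_pos_right hq, Nat.pos_of_mul_pos_left hq⟩

theorem HasWalk.mul {t : ℕ} {p : σ} (h : HasWalk A t p p) (k : ℕ) : HasWalk A (k * t) p p := by
  induction k with
  | zero => simpa using hasWalk_zero p
  | succ k ih => rw [Nat.succ_mul]; exact ih.trans h

theorem HasWalk.exists_seq {t : ℕ} {p q : σ} (h : HasWalk A t p q) :
    ∃ r : ℕ → σ, r 0 = p ∧ r t = q ∧
      ∀ i j, i ≤ j → j ≤ t → HasWalk A (j - i) (r i) (r j) := by
  induction t generalizing q with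
  | zero =>
    refine ⟨fun _ => p, rfl, ?_, fun i j hij hj => ?_⟩
    · by_contra hpq
      simp [HasWalk, Matrix.one_apply_ne hpq] at h
    · obtain rfl : j = 0 := by omega
      simpa using hasWalk_zero p
  | succ t ih =>
    obtain ⟨x, hx, hxq⟩ := h.exists_mid
    obtain ⟨r, h0, ht, hr⟩ := ih hx
    refine ⟨fun i => if i ≤ t then r i else q, by simpa using h0, by simp, fun i j hij hj => ?_⟩
    rcases Nat.lt_or_ge t j with hj' | hj'
    · obtain rfl : j = t + 1 := by omega
      rcases Nat.lt_or_ge t i with hi | hi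
      · obtain rfl : i = t + 1 := by omega
        simpa using hasWalk_zero q
      · have h1 := (hr i t hi le_rfl).trans (ht ▸ hxq)
        simpa [hi, Nat.succ_sub hi] using h1
    · simpa [hj', hij.trans hj'] using hr i j hij hj'

/-- Walks can be shortened without changing their length modulo `d`: a walk of length at least
`card σ * d` visits some state at two times that agree modulo `d`, and the part in between can be
cut out. -/
theorem HasWalk.exists_lt {t : ℕ} {p q : σ} (h : HasWalk A t p q) {d : ℕ} (hd : 0 < d) :
    ∃ t' < Fintype.card σ * d, t' ≡ t [MOD d] ∧ HasWalk A t' p q := by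
  induction t using Nat.strong_induction_on with
  | _ t ih =>
    rcases Nat.lt_or_ge t (Fintype.card σ * d) with ht | ht
    · exact ⟨t, ht, rfl, h⟩
    obtain ⟨r, h0, hrt, hr⟩ := h.exists_seq
    obtain ⟨i, j, hne, hij⟩ := Fintype.exists_ne_map_eq_of_card_lt
      (fun i : Fin (t + 1) => (r i, (⟨i % d, Nat.mod_lt _ hd⟩ : Fin d)))
      (by simpa using Nat.lt_succ_of_le ht)
    wlog hlt : i < j generalizing i j
    · exact this j i hne.symm hij.symm (lt_of_le_of_ne (not_lt.mp hlt) hne.symm)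
    simp only [Prod.mk.injEq, Fin.mk.injEq] at hij
    have hlt' : i.val < j.val := hlt
    have hj : j.val ≤ t := Nat.lt_succ_iff.mp j.isLt
    have h1 := hr 0 i (Nat.zero_le _) (hlt'.le.trans hj)
    have h2 := hr j t hj le_rfl
    rw [h0, hij.1, Nat.sub_zero] at h1
    rw [hrt] at h2
    have hmod : i.val + (t - j.val) ≡ t [MOD d] := by
      have : i.val + (t - j.val) ≡ j.val + (t - j.val) [MOD d] := Nat.ModEq.add_right _ hij.2
      rwa [Nat.add_sub_cancel' hj] at this
    obtain ⟨t', ht', hmod', hw⟩ := ih (i.val + (t - j.val)) (by omega) (h1.trans h2)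
    exact ⟨t', ht', hmod'.trans hmod, hw⟩

/-- The state `x` lies on a closed walk of positive length. -/
def OnCycle (A : Matrix σ σ ℕ) (x : σ) : Prop := ∃ c, 0 < c ∧ HasWalk A c x x

theorem HasWalk.exists_onCycle {t : ℕ} {p q : σ} (h : HasWalk A t p q) (ht : Fintype.card σ ≤ t) :
    ∃ x a b, OnCycle A x ∧ a + b = t ∧ HasWalk A a p x ∧ HasWalk A b x q := by
  obtain ⟨r, h0, hrt, hr⟩ := h.exists_seq
  obtain ⟨i, j, hne, hij⟩ := Fintype.exists_ne_map_eq_of_card_lt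
    (fun i : Fin (t + 1) => r i) (by simpa using Nat.lt_succ_of_le ht)
  wlog hlt : i < j generalizing i j
  · exact this j i hne.symm hij.symm (lt_of_le_of_ne (not_lt.mp hlt) hne.symm)
  have hlt' : i.val < j.val := hlt
  have hj : j.val ≤ t := Nat.lt_succ_iff.mp j.isLt
  refine ⟨r i, i, t - i, ⟨j - i, by omega, ?_⟩, by omega, ?_, ?_⟩
  · simpa [hij] using hr i j hlt'.le hj
  · simpa [h0] using hr 0 i (Nat.zero_le _) (by omega)
  · simpa [hrt] using hr i t (by omega) le_rfl

/-- Mutual reachability. -/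
def Conn (A : Matrix σ σ ℕ) (x y : σ) : Prop :=
  (∃ a, HasWalk A a x y) ∧ ∃ b, HasWalk A b y x

theorem Conn.refl (x : σ) : Conn A x x := ⟨⟨0, hasWalk_zero x⟩, ⟨0, hasWalk_zero x⟩⟩

theorem Conn.symm {x y : σ} (h : Conn A x y) : Conn A y x := ⟨h.2, h.1⟩

theorem Conn.trans {x y z : σ} (h₁ : Conn A x y) (h₂ : Conn A y z) : Conn A x z := by
  obtain ⟨⟨a, ha⟩, b, hb⟩ := h₁
  obtain ⟨⟨c, hc⟩, d, hd⟩ := h₂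
  exact ⟨⟨_, ha.trans hc⟩, _, hd.trans hb⟩

theorem OnCycle.of_conn {x y : σ} (hx : OnCycle A x) (h : Conn A x y) : OnCycle A y := by
  obtain ⟨c, hc, hw⟩ := hx
  obtain ⟨⟨a, ha⟩, b, hb⟩ := h
  exact ⟨b + c + a, by omega, (hb.trans hw).trans ha⟩

/-- A system of representatives of the strongly connected components that contain a cycle. -/
theorem exists_onCycle_representatives (A : Matrix σ σ ℕ) :
    ∃ T : Finset σ, (∀ u ∈ T, OnCycle A u) ∧ (∀ x, OnCycle A x → ∃ u ∈ T, Conn A x u) ∧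
      ∀ u ∈ T, ∀ v ∈ T, Conn A u v → u = v := by
  classical
  let S : Setoid σ := ⟨Conn A, ⟨Conn.refl, Conn.symm, Conn.trans⟩⟩
  let rep : σ → σ := fun x => (Quotient.mk S x).out
  have hrep : ∀ x, Conn A x (rep x) := fun x => (Quotient.mk_out (s := S) x).symm
  have hcongr : ∀ x y, Conn A x y → rep x = rep y := fun x y h => by
    have : Quotient.mk S x = Quotient.mk S y := Quotient.sound h
    simp only [rep, this]
  refine ⟨Finset.univ.filter fun u => OnCycle A u ∧ rep u = u, ?_, ?_, ?_⟩
  · intro u hu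
    exact (Finset.mem_filter.mp hu).2.1
  · intro x hx
    refine ⟨rep x, ?_, hrep x⟩
    simp only [Finset.mem_filter, Finset.mem_univ, true_and]
    exact ⟨hx.of_conn (hrep x), (hcongr _ _ (hrep x)).symm⟩
  · intro u hu v hv h
    rw [← (Finset.mem_filter.mp hu).2.2, ← (Finset.mem_filter.mp hv).2.2]
    exact hcongr u v h

/-- The least positive length of a closed walk at `u` (`0` if there is none). -/
noncomputable def cycLen (A : Matrix σ σ ℕ) (u : σ) : ℕ := sInf {c | 0 < c ∧ HasWalk A c u u}

theorem OnCycle.cycLen_pos {u : σ} (hu : OnCycle A u) : 0 < cycLen A u :=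
  (Nat.sInf_mem (s := {c | 0 < c ∧ HasWalk A c u u}) hu).1

theorem OnCycle.hasWalk_cycLen {u : σ} (hu : OnCycle A u) : HasWalk A (cycLen A u) u u :=
  (Nat.sInf_mem (s := {c | 0 < c ∧ HasWalk A c u u}) hu).2

open Classical in
theorem OnCycle.cycLen_le {u : σ} (hu : OnCycle A u) :
    cycLen A u ≤ (Finset.univ.filter fun x => Conn A x u).card := by
  obtain ⟨r, h0, hrt, hr⟩ := hu.hasWalk_cycLen.exists_seq
  have := Finset.card_le_card_of_injOn (s := Finset.range (cycLen A u))
    (t := Finset.univ.filter fun x => Conn A x u) r ?_ ?_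
  · simpa using this
  · intro i hi
    have hi' : i < cycLen A u := by simpa using hi
    have h1 := hr 0 i (Nat.zero_le _) hi'.le
    have h2 := hr i _ hi'.le le_rfl
    rw [h0] at h1
    rw [hrt] at h2
    exact Finset.mem_coe.mpr (Finset.mem_filter.mpr ⟨Finset.mem_univ _, ⟨_, h2⟩, _, h1⟩)
  · have key : ∀ i j, i < j → j < cycLen A u → r i ≠ r j := by
      intro i j hij hj h
      have h1 := hr 0 i (Nat.zero_le _) (hij.le.trans hj.le)
      have h2 := hr j _ hj.le le_rfl
      rw [h0, h] at h1
      rw [hrt] at h2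
      have : cycLen A u ≤ i - 0 + (cycLen A u - j) :=
        Nat.sInf_le (show _ ∈ {c | 0 < c ∧ HasWalk A c u u} from ⟨by omega, h1.trans h2⟩)
      omega
    intro i hi j hj h
    simp only [Finset.coe_range, Set.mem_Iio] at hi hj
    rcases lt_trichotomy i j with hij | hij | hij
    · exact absurd h (key i j hij hj)
    · exact hij
    · exact absurd h.symm (key j i hij hi)

theorem OnCycle.cycLen_le_card {u : σ} (hu : OnCycle A u) : cycLen A u ≤ Fintype.card σ := by
  classical
  exact hu.cycLen_le.trans (Finset.card_le_univ _)

theorem sum_cycLen_le_card {T : Finset σ} (hT : ∀ u ∈ T, OnCycle A u)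
    (hT' : ∀ u ∈ T, ∀ v ∈ T, Conn A u v → u = v) :
    ∑ u ∈ T, cycLen A u ≤ Fintype.card σ := by
  classical
  calc ∑ u ∈ T, cycLen A u ≤ ∑ u ∈ T, (Finset.univ.filter fun x => Conn A x u).card :=
        Finset.sum_le_sum fun u hu => (hT u hu).cycLen_le
    _ = (T.biUnion fun u => Finset.univ.filter fun x => Conn A x u).card := by
        refine (Finset.card_biUnion fun u hu v hv huv => ?_).symm
        refine Finset.disjoint_left.mpr fun x hx hx' => ?_
        simp only [Finset.mem_filter, Finset.mem_univ, true_and] at hx hx'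
        exact huv (hT' u hu v hv (hx.symm.trans hx'))
    _ ≤ Fintype.card σ := Finset.card_le_univ _

end Walks

/-! ### Components that are not simple cycles, and those that are -/

section Branching

variable {σ : Type*} [Fintype σ] [DecidableEq σ] {A : Matrix σ σ ℕ}

/-- The strongly connected component of `u` is branching if one of its states has two distinct
successors inside the component, that is, if the component is not just a simple cycle. -/
def Branching (A : Matrix σ σ ℕ) (u : σ) : Prop :=
  ∃ v w₁ w₂, Conn A v u ∧ Conn A w₁ u ∧ Conn A w₂ u ∧ w₁ ≠ w₂ ∧ HasWalk A 1 v w₁ ∧ HasWalk A 1 v w₂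

theorem two_le_pow_add_apply {s t : ℕ} {p q r₁ r₂ : σ} (hr : r₁ ≠ r₂) (h₁ : HasWalk A s p r₁)
    (h₁' : HasWalk A t r₁ q) (h₂ : HasWalk A s p r₂) (h₂' : HasWalk A t r₂ q) :
    2 ≤ (A ^ (s + t)) p q := by
  rw [pow_add_apply]
  have h := Finset.sum_le_univ_sum_of_nonneg (s := {r₁, r₂})
    (f := fun r => (A ^ s) p r * (A ^ t) r q) fun _ => Nat.zero_le _
  rw [Finset.sum_pair hr] at h
  have := Nat.mul_pos h₁ h₁'
  have := Nat.mul_pos h₂ h₂'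
  omega

/-- Two closed walks at the same state with distinct first steps give, when each is repeated as
many times as the other one is long, distinct closed walks of the same length. -/
theorem Branching.exists_two_le {u : σ} (h : Branching A u) :
    ∃ L ≤ Fintype.card σ ^ 2 + 2 * Fintype.card σ, 2 ≤ (A ^ L) u u := by
  obtain ⟨v, w₁, w₂, hv, hw₁, hw₂, hne, he₁, he₂⟩ := h
  have hret : ∀ w, Conn A w u → ∃ l < Fintype.card σ, HasWalk A l w v := fun w hw => by
    obtain ⟨⟨a, ha⟩, -⟩ := hw.trans hv.symm
    obtain ⟨l, hl, -, hlw⟩ := ha.exists_lt one_pos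
    exact ⟨l, by simpa using hl, hlw⟩
  obtain ⟨l₁, hl₁, hb₁⟩ := hret w₁ hw₁
  obtain ⟨l₂, hl₂, hb₂⟩ := hret w₂ hw₂
  obtain ⟨c₁, hc₁, hu₁⟩ := hret u (Conn.refl u)
  obtain ⟨c₂, hc₂, -, hu₂⟩ := hv.1.choose_spec.exists_lt one_pos
  rw [mul_one] at hc₂
  -- `1 + (l₁ + l₂ * (1 + l₁)) = (1 + l₁) * (1 + l₂)`: each loop is repeated as often as the
  -- other one is long.
  have hv2 : 2 ≤ (A ^ (1 + (l₁ + l₂ * (1 + l₁)))) v v := by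
    refine two_le_pow_add_apply hne he₁ (hb₁.trans ((he₁.trans hb₁).mul l₂)) he₂ ?_
    have := hb₂.trans ((he₂.trans hb₂).mul l₁)
    rwa [show l₂ + l₁ * (1 + l₂) = l₁ + l₂ * (1 + l₁) by ring] at this
  refine ⟨c₁ + (1 + (l₁ + l₂ * (1 + l₁))) + c₂, ?_, ?_⟩
  · have : (1 + l₁) * (1 + l₂) ≤ Fintype.card σ * Fintype.card σ :=
      Nat.mul_le_mul (by omega) (by omega)
    nlinarith
  · calc 2 ≤ (A ^ c₁) u v * (A ^ (1 + (l₁ + l₂ * (1 + l₁)))) v v * (A ^ c₂) v u := by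
          have h1 : 1 ≤ (A ^ c₁) u v := hu₁
          have h2 : 1 ≤ (A ^ c₂) v u := hu₂
          calc 2 = 1 * 2 * 1 := rfl
            _ ≤ _ := by gcongr
      _ ≤ _ := (Nat.mul_le_mul_right _ (mul_le_pow_add_apply _ _ _ _ _)).trans
          (mul_le_pow_add_apply _ _ _ _ _)

/-- Inside a component that is not branching, the state after `t` steps is determined. -/
theorem eq_of_hasWalk_of_not_branching {u : σ} (hu : ¬ Branching A u) {t : ℕ} {x y y' : σ}
    (hx : Conn A x u) (hy : Conn A y u) (hy' : Conn A y' u) (h : HasWalk A t x y)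
    (h' : HasWalk A t x y') : y = y' := by
  induction t generalizing x with
  | zero =>
    have key : ∀ y, HasWalk A 0 x y → x = y := fun y h => by
      by_contra hne
      simp [HasWalk, Matrix.one_apply_ne hne] at h
    rw [← key y h, ← key y' h']
  | succ t ih =>
    rw [add_comm] at h h'
    obtain ⟨w, hw, hwy⟩ := h.exists_mid
    obtain ⟨w', hw', hwy'⟩ := h'.exists_mid
    have key : ∀ w y, Conn A y u → HasWalk A 1 x w → HasWalk A t w y → Conn A w u := by
      intro w y hy hw hwy
      obtain ⟨⟨a, ha⟩, -⟩ := hy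
      obtain ⟨-, b, hb⟩ := hx
      exact ⟨⟨_, hwy.trans ha⟩, _, hb.trans hw⟩
    have hwu := key w y hy hw hwy
    have hwu' := key w' y' hy' hw' hwy'
    obtain rfl : w = w' := by
      by_contra hne
      exact hu ⟨x, w, w', hx, hwu, hwu', hne, hw, hw'⟩
    exact ih hwu hwy hwy'

/-- In a component that is not branching, walks are determined by their first state and length. -/
theorem pow_apply_le_one_of_not_branching (hA : ∀ x y, A x y ≤ 1) {u : σ} (hu : ¬ Branching A u)
    (t : ℕ) {x y : σ} (hx : Conn A x u) (hy : Conn A y u) : (A ^ t) x y ≤ 1 := by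
  induction t generalizing x with
  | zero =>
    rw [pow_zero, Matrix.one_apply]
    split_ifs <;> omega
  | succ t ih =>
    by_cases h0 : (A ^ (t + 1)) x y = 0
    · omega
    have hw : HasWalk A (1 + t) x y := by rw [add_comm]; exact Nat.pos_of_ne_zero h0
    obtain ⟨w, hw, hwy⟩ := hw.exists_mid
    have key : ∀ w, HasWalk A 1 x w → HasWalk A t w y → Conn A w u := by
      intro w hw hwy
      obtain ⟨⟨a, ha⟩, -⟩ := hy
      obtain ⟨-, b, hb⟩ := hx
      exact ⟨⟨_, hwy.trans ha⟩, _, hb.trans hw⟩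
    rw [add_comm, pow_add_apply, Finset.sum_eq_single w]
    · rw [pow_one]
      exact Nat.mul_le_mul (hA x w) (ih (key w hw hwy))
    · intro w' _ hne
      by_contra h
      have h1 : HasWalk A 1 x w' := Nat.pos_of_ne_zero (left_ne_zero_of_mul h)
      have h2 : HasWalk A t w' y := Nat.pos_of_ne_zero (right_ne_zero_of_mul h)
      exact hne (eq_of_hasWalk_of_not_branching hu hx (key w' h1 h2) (key w hw hwy) h1 hw)
    · simp

/-- A component that is not branching is a simple cycle of length `cycLen A u`, so that the number
of walks between two of its states depends only on the length modulo `cycLen A u`. -/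
theorem pow_apply_eq_of_not_branching (hA : ∀ x y, A x y ≤ 1) {u : σ} (hc : OnCycle A u)
    (hu : ¬ Branching A u) {t t' : ℕ} (htt' : t ≡ t' [MOD cycLen A u]) {x y : σ}
    (hx : Conn A x u) (hy : Conn A y u) : (A ^ t) x y = (A ^ t') x y := by
  have hclosed : HasWalk A (cycLen A u) x x := by
    obtain ⟨-, j, hj⟩ := id hx
    have h1 := hc.hasWalk_cycLen.trans hj
    rw [add_comm] at h1
    obtain ⟨x', hx', hx''⟩ := h1.exists_mid
    have hxu' : Conn A x' u := by
      obtain ⟨⟨a, ha⟩, -⟩ := hx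
      exact ⟨⟨_, hx''.trans ha⟩, _, hx'⟩
    rwa [eq_of_hasWalk_of_not_branching hu (Conn.refl u) hxu' hx hx' hj] at hx''
  have hstep : ∀ t, HasWalk A (cycLen A u + t) x y ↔ HasWalk A t x y := fun t => by
    refine ⟨fun h => ?_, fun h => hclosed.trans h⟩
    obtain ⟨x', hx', hx''⟩ := h.exists_mid
    have hxu' : Conn A x' u := by
      obtain ⟨⟨a, ha⟩, -⟩ := hy
      obtain ⟨-, b, hb⟩ := hx
      exact ⟨⟨_, hx''.trans ha⟩, _, hb.trans hx'⟩
    rwa [eq_of_hasWalk_of_not_branching hu hx hxu' hx hx' hclosed] at hx''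
  have hmul : ∀ k t, HasWalk A (cycLen A u * k + t) x y ↔ HasWalk A t x y := fun k t => by
    induction k with
    | zero => simp
    | succ k ih => rw [← ih, ← hstep (cycLen A u * k + t), mul_add, mul_one, add_right_comm,
        add_comm (_ + t)]
  have hmod : ∀ t, HasWalk A t x y ↔ HasWalk A (t % cycLen A u) x y := fun t => by
    rw [← hmul (t / cycLen A u) (t % cycLen A u), Nat.div_add_mod]
  have hiff : HasWalk A t x y ↔ HasWalk A t' x y := by
    rw [hmod t, hmod t', htt']
  have h1 := pow_apply_le_one_of_not_branching hA hu t hx hy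
  have h2 := pow_apply_le_one_of_not_branching hA hu t' hx hy
  unfold HasWalk at hiff
  omega

end Branching

/-! ### Counting accepting walks -/

section AcceptCount

variable {σ : Type*} [Fintype σ] [DecidableEq σ] {A : Matrix σ σ ℕ}

/-- The number of walks of length `z` from `s` to a state in `F`. -/
def acceptCount (A : Matrix σ σ ℕ) (s : σ) (F : Finset σ) (z : ℕ) : ℕ := ∑ q ∈ F, (A ^ z) s q

/-- Up to a multiple of `cycLen A u`, there is a walk of length `z` from `s` to `F` through `u`.
This depends on `z` modulo `cycLen A u` only. -/
def Through (A : Matrix σ σ ℕ) (s : σ) (F : Finset σ) (u : σ) (z : ℕ) : Prop :=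
  ∃ a b, ∃ q ∈ F, HasWalk A a s u ∧ HasWalk A b u q ∧ a + b ≡ z [MOD cycLen A u]

variable {s u v : σ} {F : Finset σ} {z z' : ℕ}

theorem Through.congr (h : Through A s F u z) (hz : z ≡ z' [MOD cycLen A u]) :
    Through A s F u z' := by
  obtain ⟨a, b, q, hq, ha, hb, hab⟩ := h
  exact ⟨a, b, q, hq, ha, hb, hab.trans hz⟩

theorem Through.exists_lt (hu : OnCycle A u) (h : Through A s F u z) :
    ∃ a < Fintype.card σ ^ 2, ∃ b < Fintype.card σ ^ 2, ∃ q ∈ F,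
      HasWalk A a s u ∧ HasWalk A b u q ∧ a + b ≡ z [MOD cycLen A u] := by
  obtain ⟨a, b, q, hq, ha, hb, hab⟩ := h
  obtain ⟨a', ha', hma, hwa⟩ := ha.exists_lt hu.cycLen_pos
  obtain ⟨b', hb', hmb, hwb⟩ := hb.exists_lt hu.cycLen_pos
  have hle : Fintype.card σ * cycLen A u ≤ Fintype.card σ ^ 2 := by
    rw [sq]
    exact Nat.mul_le_mul_left _ hu.cycLen_le_card
  exact ⟨a', ha'.trans_le hle, b', hb'.trans_le hle, q, hq, hwa, hwb, (hma.add hmb).trans hab⟩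

/-- A long walk through `u` can be rearranged to spend all of its time, except for short parts at
the beginning and at the end, in the component of `u`. -/
theorem Through.exists_mid (hu : OnCycle A u) (h : Through A s F u z)
    (hz : 2 * Fintype.card σ ^ 2 ≤ z) :
    ∃ r, Conn A r u ∧ ∃ q ∈ F, HasWalk A (Fintype.card σ ^ 2) s r ∧
      HasWalk A (z - Fintype.card σ ^ 2) r q := by
  obtain ⟨a, ha, b, hb, q, hq, hwa, hwb, hab⟩ := h.exists_lt hu
  set N := Fintype.card σ ^ 2
  obtain ⟨k, hk⟩ := (Nat.modEq_iff_dvd' (by omega)).mp hab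
  have hloop : HasWalk A ((N - a) + (z - N - b)) u u := by
    rw [show (N - a) + (z - N - b) = k * cycLen A u by rw [mul_comm, ← hk]; omega]
    exact hu.hasWalk_cycLen.mul k
  obtain ⟨r, h1, h2⟩ := hloop.exists_mid
  refine ⟨r, ⟨⟨_, h2⟩, _, h1⟩, q, hq, ?_, ?_⟩
  · have := hwa.trans h1
    rwa [Nat.add_sub_cancel' ha.le] at this
  · have := h2.trans hwb
    rwa [show z - N - b + b = z - N by omega] at this

theorem acceptCount_add (m z : ℕ) :
    acceptCount A s F (m + z) = ∑ r, (A ^ m) s r * acceptCount A r F z := by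
  simp only [acceptCount, pow_add_apply, Finset.mul_sum]
  rw [Finset.sum_comm]

theorem acceptCount_pos_iff : 0 < acceptCount A s F z ↔ ∃ q ∈ F, HasWalk A z s q := by
  rw [acceptCount, Finset.sum_pos_iff]
  rfl

theorem pow_apply_le_acceptCount {q : σ} (hq : q ∈ F) : (A ^ z) s q ≤ acceptCount A s F z :=
  Finset.single_le_sum (f := fun q => (A ^ z) s q) (fun _ _ => Nat.zero_le _) hq

theorem Through.acceptCount_pos (hu : OnCycle A u) (h : Through A s F u z)
    (hz : 2 * Fintype.card σ ^ 2 ≤ z) : 0 < acceptCount A s F z := by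
  obtain ⟨r, -, q, hq, h1, h2⟩ := h.exists_mid hu hz
  refine acceptCount_pos_iff.mpr ⟨q, hq, ?_⟩
  have := h1.trans h2
  rwa [Nat.add_sub_cancel' (by omega)] at this

/-- Accepting walks through distinct components that contain a cycle give two accepting walks of
the same length: at time `card σ ^ 2` they can be taken to be in these components. -/
theorem two_le_acceptCount_of_not_conn (hu : OnCycle A u) (hv : OnCycle A v) (huv : ¬ Conn A u v)
    (h : Through A s F u z) (h' : Through A s F v z) (hz : 2 * Fintype.card σ ^ 2 ≤ z) :
    2 ≤ acceptCount A s F z := by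
  obtain ⟨r, hr, q, hq, h1, h2⟩ := h.exists_mid hu hz
  obtain ⟨r', hr', q', hq', h1', h2'⟩ := h'.exists_mid hv hz
  have hne : r ≠ r' := by
    rintro rfl
    exact huv (hr.symm.trans hr')
  rw [← Nat.add_sub_cancel' (show Fintype.card σ ^ 2 ≤ z by omega), acceptCount_add]
  have hsum := Finset.sum_le_univ_sum_of_nonneg (s := {r, r'})
    (f := fun r => (A ^ (Fintype.card σ ^ 2)) s r * acceptCount A r F (z - Fintype.card σ ^ 2))
    fun _ => Nat.zero_le _
  rw [Finset.sum_pair hne] at hsum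
  have := Nat.mul_pos h1 (acceptCount_pos_iff.mpr ⟨q, hq, h2⟩)
  have := Nat.mul_pos h1' (acceptCount_pos_iff.mpr ⟨q', hq', h2'⟩)
  omega

/-- Visiting the component of `u` is as good as visiting `u`. -/
theorem through_of_hasWalk {a b : ℕ} {x q : σ} (hu : OnCycle A u) (hxu : Conn A x u) (hq : q ∈ F)
    (ha : HasWalk A a s x) (hb : HasWalk A b x q) : Through A s F u (a + b) := by
  obtain ⟨⟨c, hc⟩, d, hd⟩ := hxu
  -- The detour from `x` to `u` and back is made `cycLen A u` times.
  refine ⟨a + c, d + (cycLen A u - 1) * (c + d) + b, q, hq, ha.trans hc,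
    (hd.trans ((hc.trans hd).mul _)).trans hb, ?_⟩
  have h : a + c + (d + (cycLen A u - 1) * (c + d) + b) = a + b + cycLen A u * (c + d) := by
    obtain ⟨k, hk⟩ := Nat.exists_eq_add_of_lt hu.cycLen_pos
    rw [hk, zero_add, Nat.add_sub_cancel]
    ring
  rw [h]
  simp [Nat.ModEq]

theorem exists_through {T : Finset σ} (hT : ∀ u ∈ T, OnCycle A u)
    (hrep : ∀ x, OnCycle A x → ∃ u ∈ T, Conn A x u) (hz : Fintype.card σ ≤ z)
    (h : 0 < acceptCount A s F z) : ∃ u ∈ T, Through A s F u z := by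
  obtain ⟨q, hq, hw⟩ := acceptCount_pos_iff.mp h
  obtain ⟨x, a, b, hx, rfl, ha, hb⟩ := hw.exists_onCycle hz
  obtain ⟨u, hu, hxu⟩ := hrep x hx
  exact ⟨u, hu, through_of_hasWalk (hT u hu) hxu hq ha hb⟩

/-- The lengths involved are two ends of length at most `card σ ^ 2` each and a closed walk at `u`,
of length at most `3 * card σ ^ 3`, that has a distinct companion of the same length. -/
theorem Branching.two_le_acceptCount (hu : OnCycle A u) (hb : Branching A u)
    (h : Through A s F u z) (hz : 5 * Fintype.card σ ^ 3 ≤ z) : 2 ≤ acceptCount A s F z := by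
  obtain ⟨a, ha, b, hb', q, hq, hwa, hwb, hab⟩ := h.exists_lt hu
  obtain ⟨L, hL, hL2⟩ := hb.exists_two_le
  have hn : 1 ≤ Fintype.card σ := Fintype.card_pos_iff.mpr ⟨u⟩
  have hd := hu.cycLen_le_card
  set n := Fintype.card σ
  set d := cycLen A u
  -- Repeating the closed walks of length `L` makes their length a multiple of `d`.
  have hdL : 2 ≤ (A ^ (d * L)) u u := by
    have hLw : HasWalk A L u u := by unfold HasWalk; omega
    have h1 : 1 ≤ (A ^ ((d - 1) * L)) u u := hLw.mul (d - 1)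
    have h2 := mul_le_pow_add_apply (A := A) ((d - 1) * L) L u u u
    have hd1 : 0 < d := hu.cycLen_pos
    rw [show (d - 1) * L + L = d * L by
      obtain ⟨k, hk⟩ := Nat.exists_eq_add_of_lt hd1
      rw [hk, zero_add, Nat.add_sub_cancel]
      ring] at h2
    exact (Nat.mul_le_mul h1 hL2).trans h2
  have hlen : a + b + d * L ≤ z := by
    have h1 : d * L ≤ n * (n ^ 2 + 2 * n) := Nat.mul_le_mul hd hL
    have h2 : n ^ 2 ≤ n ^ 3 := Nat.pow_le_pow_right hn (by norm_num)
    have h3 : n * (n ^ 2 + 2 * n) = n ^ 3 + 2 * n ^ 2 := by ring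
    omega
  have hmod : a + b + d * L ≡ z [MOD d] := by
    refine Nat.ModEq.trans ?_ hab
    simp [Nat.ModEq]
  obtain ⟨k, hk⟩ := (Nat.modEq_iff_dvd' hlen).mp hmod
  have hz' : z = a + d * L + (k * d + b) := by
    rw [mul_comm k, ← hk]
    omega
  have h1 : 1 ≤ (A ^ a) s u := hwa
  have h2 : 1 ≤ (A ^ (k * d + b)) u q := (hu.hasWalk_cycLen.mul k).trans hwb
  calc 2 = 1 * 2 * 1 := rfl
    _ ≤ (A ^ a) s u * (A ^ (d * L)) u u * (A ^ (k * d + b)) u q := by gcongr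
    _ ≤ (A ^ z) s q := by
        rw [hz']
        exact (Nat.mul_le_mul_right _ (mul_le_pow_add_apply _ _ _ _ _)).trans
          (mul_le_pow_add_apply _ _ _ _ _)
    _ ≤ _ := pow_apply_le_acceptCount hq

/-- If all accepting walks of length `z` pass through the component of `u` only, and this
component is a simple cycle, then the number of accepting walks cannot decrease when the time
spent in this component changes by a multiple of the length of the cycle. -/
theorem acceptCount_le_of_not_branching (hA : ∀ x y, A x y ≤ 1) {T : Finset σ}
    (hT : ∀ u ∈ T, OnCycle A u) (hrep : ∀ x, OnCycle A x → ∃ u ∈ T, Conn A x u)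
    (hu : OnCycle A u) (hb : ¬ Branching A u) (huniq : ∀ v ∈ T, Through A s F v z → v = u)
    (hz : 2 * Fintype.card σ ≤ z) (hz' : 2 * Fintype.card σ ≤ z')
    (hzz' : z ≡ z' [MOD cycLen A u]) : acceptCount A s F z ≤ acceptCount A s F z' := by
  set n := Fintype.card σ with hn
  have hexp : ∀ z, 2 * n ≤ z → acceptCount A s F z =
      ∑ q ∈ F, ∑ y, (∑ x, (A ^ n) s x * (A ^ (z - 2 * n)) x y) * (A ^ n) y q := by
    intro z hz
    have : z = n + (z - 2 * n) + n := by omega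
    conv_lhs => rw [this]
    simp only [acceptCount, pow_add_apply _ n, pow_add_apply n _]
  have hmid : ∀ x y, ∀ q ∈ F, HasWalk A n s x → HasWalk A (z - 2 * n) x y → HasWalk A n y q →
      Conn A x u ∧ Conn A y u := by
    intro x y q hq h1 h2 h3
    -- The first and the last `n` steps both meet a cycle, which can only be in the component
    -- of `u`, and the walk cannot leave this component in between.
    obtain ⟨x₁, a, b, hx₁, hab, ha, hb⟩ := h1.exists_onCycle le_rfl
    obtain ⟨y₁, a', b', hy₁, hab', ha', hb'⟩ := h3.exists_onCycle le_rfl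
    have key : ∀ x₁ a b, OnCycle A x₁ → a + b = z → HasWalk A a s x₁ → HasWalk A b x₁ q →
        Conn A x₁ u := by
      intro x₁ a b hx₁ hab ha hb
      obtain ⟨v, hv, hvu⟩ := hrep x₁ hx₁
      have := through_of_hasWalk (hT v hv) hvu hq ha hb
      rw [hab] at this
      rwa [huniq v hv this] at hvu
    obtain ⟨-, c, hc⟩ := key x₁ a (b + (z - 2 * n) + n) hx₁ (by omega) ha ((hb.trans h2).trans h3)
    obtain ⟨⟨c', hc'⟩, -⟩ := key y₁ (n + (z - 2 * n) + a') b' hy₁ (by omega)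
      ((h1.trans h2).trans ha') hb'
    exact ⟨⟨⟨_, (h2.trans ha').trans hc'⟩, _, hc.trans hb⟩,
      ⟨_, ha'.trans hc'⟩, _, (hc.trans hb).trans h2⟩
  have hmod : z - 2 * n ≡ z' - 2 * n [MOD cycLen A u] :=
    Nat.ModEq.add_right_cancel' (2 * n) (by rwa [Nat.sub_add_cancel hz, Nat.sub_add_cancel hz'])
  rw [hexp z hz, hexp z' hz']
  simp only [Finset.sum_mul]
  refine Finset.sum_le_sum fun q hq => Finset.sum_le_sum fun y _ => Finset.sum_le_sum fun x _ => ?_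
  by_cases h0 : (A ^ n) s x * (A ^ (z - 2 * n)) x y * (A ^ n) y q = 0
  · rw [h0]
    exact Nat.zero_le _
  · have h1 := left_ne_zero_of_mul h0
    obtain ⟨hx, hy⟩ := hmid x y q hq (Nat.pos_of_ne_zero (left_ne_zero_of_mul h1))
      (Nat.pos_of_ne_zero (right_ne_zero_of_mul h1)) (Nat.pos_of_ne_zero (right_ne_zero_of_mul h0))
    rw [pow_apply_eq_of_not_branching hA hu hb hmod hx hy]

/-- The acceptance condition on the two cycles of length `cycLen A u`, which depends on `z` modulo
`cycLen A u` only: the first one accepts if there is an accepting walk through `u`, the second one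
if from some point on (namely from `z₀` on) there are always at least two accepting walks. -/
def CycleAccepts (A : Matrix σ σ ℕ) (s : σ) (F : Finset σ) (z₀ : ℕ) (c : σ × Bool) (z : ℕ) :
    Prop :=
  match c.2 with
  | false => Through A s F c.1 z
  | true => ∀ z', z₀ ≤ z' → z' ≡ z [MOD cycLen A c.1] → 2 ≤ acceptCount A s F z'

theorem CycleAccepts.congr {z₀ : ℕ} {c : σ × Bool} (h : CycleAccepts A s F z₀ c z)
    (hz : z ≡ z' [MOD cycLen A c.1]) : CycleAccepts A s F z₀ c z' := by
  obtain ⟨u, _ | _⟩ := c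
  · exact Through.congr h hz
  · exact fun z'' h₁ h₂ => h z'' h₁ (h₂.trans hz.symm)

/-- For long words, uniqueness of the accepting walk is the same as uniqueness of the accepting
cycle. -/
theorem acceptCount_eq_one_iff (hA : ∀ x y, A x y ≤ 1) {T : Finset σ}
    (hT : ∀ u ∈ T, OnCycle A u) (hrep : ∀ x, OnCycle A x → ∃ u ∈ T, Conn A x u)
    (hT' : ∀ u ∈ T, ∀ v ∈ T, Conn A u v → u = v) (hz : 5 * Fintype.card σ ^ 3 ≤ z) :
    acceptCount A s F z = 1 ↔
      ∃! c : T × Bool, CycleAccepts A s F (5 * Fintype.card σ ^ 3) (c.1, c.2) z := by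
  have hn : 1 ≤ Fintype.card σ := Fintype.card_pos_iff.mpr ⟨s⟩
  have hn2 : Fintype.card σ ≤ Fintype.card σ ^ 2 := Nat.le_self_pow (by norm_num) _
  have hn3 : Fintype.card σ ^ 2 ≤ Fintype.card σ ^ 3 := Nat.pow_le_pow_right hn (by norm_num)
  have huniq : acceptCount A s F z < 2 →
      ∀ u ∈ T, ∀ v ∈ T, Through A s F u z → Through A s F v z → v = u := by
    intro h2 u hu v hv h h'
    by_contra hne
    have := two_le_acceptCount_of_not_conn (hT u hu) (hT v hv)
      (fun hc => hne (hT' u hu v hv hc).symm) h h' (by omega)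
    omega
  constructor
  · intro h1
    obtain ⟨u, hu, hthr⟩ := exists_through hT hrep (s := s) (F := F) (z := z) (by omega) (by omega)
    refine ⟨(⟨u, hu⟩, false), hthr, ?_⟩
    rintro ⟨⟨v, hv⟩, _ | _⟩ hacc
    · have := huniq (by omega) u hu v hv hthr hacc
      subst this
      rfl
    · have := hacc z hz rfl
      omega
  · rintro ⟨⟨⟨u, hu⟩, b⟩, hacc, hu'⟩
    cases b with
    | true =>
      have h2 : 2 ≤ acceptCount A s F z := hacc z hz rfl
      obtain ⟨v, hv, hthr⟩ := exists_through hT hrep (s := s) (F := F) (z := z)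
        (by omega) (by omega)
      have := congrArg Prod.snd (hu' (⟨v, hv⟩, false) hthr)
      simp at this
    | false =>
      have hthr : Through A s F u z := hacc
      have hpos := hthr.acceptCount_pos (hT u hu) (by omega)
      by_contra hne
      have huniq' : ∀ v ∈ T, Through A s F v z → v = u := fun v hv h =>
        congrArg (fun c : T × Bool => (c.1 : σ)) (hu' (⟨v, hv⟩, false) h)
      have htwo : CycleAccepts A s F (5 * Fintype.card σ ^ 3) (u, true) z := by
        intro z' hz' hmod
        by_cases hb : Branching A u
        · exact hb.two_le_acceptCount (hT u hu) (hthr.congr hmod.symm) hz'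
        · have := acceptCount_le_of_not_branching hA hT hrep (hT u hu) hb huniq' (z' := z')
            (by omega) (by omega) hmod.symm
          omega
      have := congrArg Prod.snd (hu' (⟨u, hu⟩, true) htwo)
      simp at this

end AcceptCount

/-! ### The transition graph of a unary automaton -/

namespace XNFA

open Classical in
/-- The adjacency matrix of the transition graph of a unary automaton. -/
noncomputable def adj {σ : Type*} (M : XNFA Unit σ) : Matrix σ σ ℕ :=
  Matrix.of fun p q => if q ∈ M.step p () then 1 else 0

theorem adj_le_one {σ : Type*} (M : XNFA Unit σ) (p q : σ) : M.adj p q ≤ 1 := by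
  rw [adj, Matrix.of_apply]
  split_ifs <;> omega

end XNFA

/-- The power of a matrix as a sum over state sequences, in the encoding used by `XNFA.IsPath`. -/
theorem Matrix.pow_apply_eq_sum_prod {σ : Type*} [Fintype σ] [DecidableEq σ] (A : Matrix σ σ ℕ)
    (z : ℕ) (s q : σ) :
    (A ^ z) s q = ∑ p : Fin (z + 1) → σ, if p 0 = s ∧ p (Fin.last z) = q then
      ∏ i : Fin z, A (p i.castSucc) (p i.succ) else 0 := by
  induction z generalizing s with
  | zero =>
    rw [← (Equiv.funUnique (Fin 1) σ).symm.sum_comp]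
    simp [Matrix.one_apply, ite_and]
  | succ z ih =>
    rw [pow_succ', Matrix.mul_apply, ← (Fin.consEquiv fun _ => σ).sum_comp, Fintype.sum_prod_type]
    symm
    rw [Finset.sum_eq_single s]
    · simp only [ih, Finset.mul_sum]
      rw [Finset.sum_comm]
      refine Finset.sum_congr rfl fun p _ => ?_
      rw [Finset.sum_eq_single (p 0)]
      · simp [← Fin.succ_last, Fin.prod_univ_succ]
      · intro r _ hr
        simp [hr.symm]
      · simp
    · intro x _ hx
      simp [hx]
    · simp

namespace XNFA

open Classical in
theorem mem_accepts_iff_acceptCount {σ : Type*} [Fintype σ] [DecidableEq σ] (M : XNFA Unit σ)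
    (w : List Unit) : w ∈ M.accepts ↔
      acceptCount M.adj M.start (Finset.univ.filter (· ∈ M.accept)) w.length = 1 := by
  have hcount : acceptCount M.adj M.start (Finset.univ.filter (· ∈ M.accept)) w.length =
      (Finset.univ.filter fun p => M.IsAcceptingPath w p).card := by
    rw [acceptCount, Finset.card_filter]
    simp only [Matrix.pow_apply_eq_sum_prod]
    rw [Finset.sum_comm]
    refine Finset.sum_congr rfl fun p _ => ?_
    have hprod : ∏ i : Fin w.length, M.adj (p i.castSucc) (p i.succ) =
        if ∀ i : Fin w.length, p i.succ ∈ M.step (p i.castSucc) (w.get i) then 1 else 0 := by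
      simp only [adj, Matrix.of_apply, Finset.prod_ite_zero, Finset.prod_const_one,
        Finset.mem_univ, true_implies]
    simp only [hprod, IsAcceptingPath, IsPath, ite_and, Finset.sum_filter]
    rw [Finset.sum_eq_single (p (Fin.last w.length))]
    · split_ifs <;> simp_all
    · intro q _ hq
      simp [hq.symm]
    · simp
  rw [hcount, Finset.card_eq_one, Finset.singleton_iff_unique_mem]
  change (∃! p, M.IsAcceptingPath w p) ↔ _
  simp [ExistsUnique]

end XNFA

/-! ### The normal form of a unary automaton -/

/-- An automaton in Chrobak normal form from a property `P` of word lengths that, from `z₀` on,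
says that exactly one of finitely many periodic conditions holds: the `i`-th condition, of period
`d i`, provides the accepting states of the `i`-th cycle. -/
theorem exists_chrobak {ι : Type*} [Fintype ι] (d : ι → ℕ) (hd : ∀ i, 1 ≤ d i) {z₀ : ℕ}
    (hz₀ : 1 ≤ z₀) (P : ℕ → Prop) (acc : ι → ℕ → Prop)
    (hacc : ∀ i z z', z ≡ z' [MOD d i] → acc i z → acc i z')
    (h : ∀ z, z₀ ≤ z → (P z ↔ ∃! i, acc i z)) :
    ∃ N : Chrobak, N.m + 1 = z₀ ∧ ∑ i, N.len i = ∑ i, d i ∧ N.period = Finset.univ.lcm d ∧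
      ∀ w, w ∈ N.toXNFA.accepts ↔ P w.length := by
  let e : Fin (Fintype.card ι) ≃ ι := (Fintype.equivFin ι).symm
  let N : Chrobak :=
    { m := z₀ - 1
      k := Fintype.card ι
      len := fun i => d (e i)
      len_pos := fun i => hd (e i)
      tailAccept := {i | P i}
      cycleAccept := {s | acc (e s.1) (s.2 + z₀)} }
  have hm : N.m + 1 = z₀ := Nat.sub_add_cancel hz₀
  refine ⟨N, hm, e.sum_comp d, ?_, fun w => ?_⟩
  · refine Nat.dvd_antisymm (Finset.lcm_dvd fun i _ => Finset.dvd_lcm (Finset.mem_univ (e i)))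
      (Finset.lcm_dvd fun i _ => ?_)
    have : N.len (e.symm i) ∣ N.period := Finset.dvd_lcm (Finset.mem_univ (e.symm i))
    rwa [show N.len (e.symm i) = d i from congrArg d (e.apply_symm_apply i)] at this
  · rcases Nat.lt_or_ge w.length (N.m + 1) with hw | hw
    · exact N.mem_accepts_of_le hw
    · rw [N.mem_accepts_of_lt hw, h _ (hm ▸ hw), e.bijective.existsUnique_iff]
      refine existsUnique_congr fun c => ?_
      have hmod : (w.length - (N.m + 1)) % N.len c + z₀ ≡ w.length [MOD d (e c)] := by
        have := (Nat.mod_modEq (w.length - (N.m + 1)) (d (e c))).add_right (N.m + 1)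
        rw [Nat.sub_add_cancel hw] at this
        exact hm ▸ this
      exact ⟨hacc _ _ _ hmod, hacc _ _ _ hmod.symm⟩

/-- Unary `n`-state XNFAs can be converted, through Chrobak normal form, to DFAs with
`e^{Θ(√(n ln n))}` states. -/
theorem mainTheorem1 :
    ∃ C : ℕ,
      (fun n : ℕ => Real.log ((C * n ^ 3 + landau n : ℕ) : ℝ)) =Θ[Filter.atTop]
        (fun n : ℕ => Real.sqrt ((n : ℝ) * Real.log (n : ℝ))) ∧
      ∀ n : ℕ, 1 ≤ n → ∀ (σ : Type*) [Fintype σ], Fintype.card σ = n →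
        ∀ M : XNFA Unit σ, ∃ N : Chrobak,
          N.toXNFA.accepts = M.accepts ∧
          Fintype.card N.State ≤ C * n ^ 3 ∧
          ∑ i, N.len i ≤ C * n ∧
          N.toDFA.accepts = M.accepts ∧
          N.m + 1 ≤ C * n ^ 3 ∧
          N.period ≤ landau n ∧
          Fintype.card N.DState ≤ C * n ^ 3 + landau n := by
  classical
  refine ⟨7, log_cube_add_landau_isTheta 7, ?_⟩
  rintro n hn σ _ rfl M
  obtain ⟨T, hT, hrep, hT'⟩ := exists_onCycle_representatives M.adj
  have hsum := sum_cycLen_le_card hT hT'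
  have hn3 : Fintype.card σ ≤ Fintype.card σ ^ 3 := Nat.le_self_pow (by norm_num) _
  obtain ⟨N, hm, hlen, hperiod, hN⟩ := exists_chrobak
    (fun c : T × Bool => cycLen M.adj (c.1 : σ)) (fun c => (hT c.1 c.1.2).cycLen_pos)
    (z₀ := 5 * Fintype.card σ ^ 3) (by omega)
    (fun z => acceptCount M.adj M.start (Finset.univ.filter (· ∈ M.accept)) z = 1)
    (fun c => CycleAccepts M.adj M.start (Finset.univ.filter (· ∈ M.accept))
      (5 * Fintype.card σ ^ 3) (c.1, c.2))
    (fun c z z' hz h => CycleAccepts.congr h hz)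
    (fun z hz => acceptCount_eq_one_iff M.adj_le_one hT hrep hT' hz)
  have haccepts : N.toXNFA.accepts = M.accepts := by
    ext w
    rw [hN, M.mem_accepts_iff_acceptCount]
  have hlen' : ∑ i, N.len i ≤ 2 * Fintype.card σ := by
    rw [hlen, Fintype.sum_prod_type]
    simp only [Finset.sum_const, Finset.card_univ, Fintype.card_bool, smul_eq_mul,
      ← Finset.mul_sum]
    rw [Finset.sum_coe_sort T (cycLen M.adj)]
    omega
  have hperiod' : N.period ≤ landau (Fintype.card σ) := by
    have h0 : ∀ u ∈ T, cycLen M.adj u ≠ 0 := fun u hu => (hT u hu).cycLen_pos.ne'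
    refine le_trans (Nat.le_of_dvd (Nat.pos_of_ne_zero ?_) ?_)
      (lcm_le_landau T (cycLen M.adj) h0 hsum)
    · rw [Ne, Finset.lcm_eq_zero_iff]
      rintro ⟨u, hu, hu0⟩
      exact h0 u hu hu0
    · rw [hperiod]
      exact Finset.lcm_dvd fun c _ => Finset.dvd_lcm c.1.2
  refine ⟨N, haccepts, ?_, by omega, by rw [N.toDFA_accepts, haccepts], by omega, hperiod', ?_⟩
  · rw [Fintype.card_sum, Fintype.card_sigma, Fintype.card_fin]
    simp only [Fintype.card_fin]
    omega
  · rw [Fintype.card_sum, Fintype.card_fin, Fintype.card_fin]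
    omega
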